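/- Let $C[0,1]$ be the space of continuous maps $f:[0,1]\to[0,1]$ with the topology of uniform convergence; a property is called typical if it holds for every $f$ in some dense $G_\delta$ subset of $C[0,1]$. Let $\{\Psi_i\}_{i\ge 1}$ be a dense sequence in $C[0,1]$ and, for Borel probability measures $\mu,\nu$ on $[0,1]$, let $$\operatorname{dist}(\mu,\nu)=\sum_{i=1}^\infty \frac1{2^i}\left|\int\Psi_i\,d\mu-\int\Psi_i\,d\nu\right| ,$$ a metric that induces the weak$^*$ topology. For $f\in C[0,1]$ and $x\in[0,1]$, let $p\omega(x)$ be the set of weak$^*$ limits of convergent subsequences of $\left\{\frac1n\sum_{j=0}^{n-1}\delta_{f^j(x)}\right\}_{n\ge1}$. A Borel probability measure $\mu$ on $[0,1]$ is pseudo-physical for $f$ if for every $\varepsilon>0$ the set $\{x\in[0,1]:\operatorname{dist}(p\omega(x),\mu)<\varepsilon\}$ has positive Lebesgue measure, where $\operatorname{dist}(p\omega(x),\mu)=\inf_{\nu\in p\omega(x)}\operatorname{dist}(\nu,\mu)$. Let $\mathcal O_f$ be the set of pseudo-physical measures for $f$, and let $\mathcal M_f$ be the space of $f$-invariant Borel probability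 measures with the weak$^*$ topology. **Theorem.** For a typical $f\in C[0,1]$, $\mathcal O_f$ is contained in $\mathcal M_f$, and it is a closed subset of $\mathcal M_f$ with empty interior in $\mathcal M_f$. Hence $\mathcal O_f$ is meager in $\mathcal M_f$, and $\mathcal M_f\setminus\mathcal O_f$ is dense in $\mathcal M_f$. -/

import Mathlib

open MeasureTheory Filter Topology
open scoped unitInterval ENNReal

noncomputable section

namespace IntervalDynamics

/-- A property of continuous maps `[0,1] → [0,1]` is typical if it holds for all maps in some
dense `G_δ` subset of `C([0,1],[0,1])` (topology of uniform convergence). -/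
def IsTypical (P : C(I, I) → Prop) : Prop :=
  ∃ G : Set C(I, I), IsGδ G ∧ Dense G ∧ ∀ f ∈ G, P f

/-- `∑_{i ≥ 1} 2^{-i} |∫ Ψ_i dμ - ∫ Ψ_i dν|`, with the sequence `Ψ` indexed from `0`. -/
def measureDist (Ψ : ℕ → C(I, I)) (μ ν : ProbabilityMeasure I) : ℝ :=
  ∑' i : ℕ, (1 / 2 ^ (i + 1)) *
    |(∫ x, (Ψ i x : ℝ) ∂(μ : Measure I)) - ∫ x, (Ψ i x : ℝ) ∂(ν : Measure I)|

/-- The distance from a set `S` of measures to `μ`: the infimum of the distances from its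
elements (and `∞` if `S` is empty). -/
def measureInfDist (Ψ : ℕ → C(I, I)) (S : Set (ProbabilityMeasure I))
    (μ : ProbabilityMeasure I) : ℝ≥0∞ :=
  ⨅ ν ∈ S, ENNReal.ofReal (measureDist Ψ ν μ)

/-- `(1 / (n + 1)) ∑_{j=0}^{n} δ_{f^j x}`; the shift makes the number of atoms positive. -/
def empiricalMeasure (f : C(I, I)) (x : I) (n : ℕ) : ProbabilityMeasure I :=
  ⟨((n + 1 : ℕ) : ℝ≥0∞)⁻¹ • ∑ j ∈ Finset.range (n + 1), Measure.dirac (f^[j] x), by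
    constructor
    simp only [Measure.smul_apply, Measure.coe_finsetSum, Finset.sum_apply, measure_univ,
      Finset.sum_const, Finset.card_range, nsmul_eq_mul, mul_one, smul_eq_mul]
    exact ENNReal.inv_mul_cancel (by simp) (ENNReal.natCast_ne_top _)⟩

/-- The set `pω(x)` of weak-* limits of convergent subsequences of the empirical measures. -/
def pOmega (f : C(I, I)) (x : I) : Set (ProbabilityMeasure I) :=
  {μ | ∃ φ : ℕ → ℕ, StrictMono φ ∧ Tendsto (fun k => empiricalMeasure f x (φ k)) atTop (𝓝 μ)}

/-- The set `O_f` of pseudo-physical measures: for each `ε > 0` the set of points `x` with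
`dist (pω(x), μ) < ε` has positive Lebesgue measure. -/
def pseudoPhysicalMeasures (Ψ : ℕ → C(I, I)) (f : C(I, I)) : Set (ProbabilityMeasure I) :=
  {μ | ∀ ε : ℝ, 0 < ε →
    0 < (volume : Measure I) {x | measureInfDist Ψ (pOmega f x) μ < ENNReal.ofReal ε}}

/-- The set `M_f` of `f`-invariant Borel probability measures. -/
def invariantMeasures (f : C(I, I)) : Set (ProbabilityMeasure I) :=
  {μ | MeasurePreserving f (μ : Measure I) (μ : Measure I)}

/-- The pseudo-physical measures as a subset of the space `M_f`, which carries the subspace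
topology of the weak-* topology. -/
def pseudoPhysicalInInvariant (Ψ : ℕ → C(I, I)) (f : C(I, I)) : Set (invariantMeasures f) :=
  {μ | (μ : ProbabilityMeasure I) ∈ pseudoPhysicalMeasures Ψ f}

end IntervalDynamics

end

/-!
Every `ν ∈ pω(x)` is invariant, and since `dist` induces the weak-* topology, `O_f` lies in the
closure of `⋃ x, pω(x)`, hence in `M_f`. A typical map `f` sends each of two disjoint closed
intervals into its own interior: near a fixed point, `f` is within `ε` of a map that is constant on
each of the two intervals. No orbit visits both traps, so the measures in `pω(x)`, and by openness
the limits of such measures, charge at most one of them. But each trap contains a fixed point, and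
mixing a small multiple of the two point masses into any `μ ∈ M_f` produces invariant measures that
charge both traps and converge to `μ`; so `O_f` is nowhere dense.
-/

namespace IntervalDynamics

section WeakConvergence

variable {X : Type*} [MeasurableSpace X]

lemma integrable_coe_unitInterval {μ : Measure X} [IsFiniteMeasure μ] {g : X → I}
    (hg : AEMeasurable g μ) : Integrable (fun x => (g x : ℝ)) μ :=
  .of_mem_Icc 0 1 (measurable_subtype_coe.comp_aemeasurable hg) (ae_of_all _ fun x => (g x).2)

lemma integral_coe_unitInterval_mem_Icc {μ : Measure X} [IsProbabilityMeasure μ] {g : X → I}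
    (hg : AEMeasurable g μ) : ∫ x, (g x : ℝ) ∂μ ∈ Set.Icc (0 : ℝ) 1 :=
  (convex_Icc 0 1).integral_mem isClosed_Icc (ae_of_all _ fun x => (g x).2)
    (integrable_coe_unitInterval hg)

variable [TopologicalSpace X] [OpensMeasurableSpace X]

lemma continuous_integral_coe_unitInterval (g : C(X, I)) :
    Continuous fun μ : ProbabilityMeasure X => ∫ x, (g x : ℝ) ∂(μ : Measure X) :=
  ProbabilityMeasure.continuous_integral_boundedContinuousFunction <|
    .mkOfBound ⟨fun x => (g x : ℝ), by fun_prop⟩ 1 fun x y =>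
      Real.dist_le_of_mem_Icc_01 (g x).2 (g y).2

lemma lipschitzWith_integral_coe_unitInterval [CompactSpace X] (μ : Measure X)
    [IsProbabilityMeasure μ] : LipschitzWith 1 fun g : C(X, I) => ∫ x, (g x : ℝ) ∂μ := by
  refine LipschitzWith.mk_one fun g h => ?_
  rw [dist_eq_norm, ← integral_sub (integrable_coe_unitInterval g.continuous.aemeasurable)
    (integrable_coe_unitInterval h.continuous.aemeasurable)]
  have pointwise (x : X) : ‖(g x : ℝ) - h x‖ ≤ dist g h :=
    ContinuousMap.dist_apply_le_dist (f := g) (g := h) x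
  simpa using norm_integral_le_of_norm_le_const (μ := μ) (ae_of_all _ pointwise)

lemma exists_eq_affine_coe_unitInterval {Y : Type*} [TopologicalSpace Y]
    (φ : BoundedContinuousFunction Y ℝ) :
    ∃ (g : C(Y, I)) (a b : ℝ), ∀ y, φ y = a * g y + b := by
  have hC : -(‖φ‖ + 1) < ‖φ‖ + 1 := by linarith [norm_nonneg φ]
  have hφ (y : Y) : φ y ∈ Set.Icc (-(‖φ‖ + 1)) (‖φ‖ + 1) :=
    abs_le.1 ((φ.norm_coe_le_norm y).trans (by linarith))
  let e := iccHomeoI _ _ hC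
  refine ⟨⟨fun y => e ⟨φ y, hφ y⟩, by fun_prop⟩, ‖φ‖ + 1 - -(‖φ‖ + 1), -(‖φ‖ + 1), fun y => ?_⟩
  rw [ContinuousMap.coe_mk, ← iccHomeoI_symm_apply_coe _ _ hC, e.symm_apply_apply]

variable {ι : Type*} {L : Filter ι} {u : ι → ProbabilityMeasure X} {μ : ProbabilityMeasure X}

lemma tendsto_of_forall_integral_coe_unitInterval_tendsto
    (h : ∀ g : C(X, I), Tendsto (fun k => ∫ x, (g x : ℝ) ∂(u k : Measure X)) L
      (𝓝 (∫ x, (g x : ℝ) ∂(μ : Measure X)))) : Tendsto u L (𝓝 μ) := by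
  refine ProbabilityMeasure.tendsto_iff_forall_integral_tendsto.2 fun φ => ?_
  obtain ⟨g, a, b, hφ⟩ := exists_eq_affine_coe_unitInterval φ
  have integral_φ (ν : ProbabilityMeasure X) :
      ∫ x, φ x ∂(ν : Measure X) = a * ∫ x, (g x : ℝ) ∂(ν : Measure X) + b := by
    simp only [hφ]
    rw [integral_add ((integrable_coe_unitInterval g.continuous.aemeasurable).const_mul a)
      (integrable_const b), integral_const_mul, integral_const, probReal_univ, one_smul]
  simp only [integral_φ]
  exact ((h g).const_mul a).add_const b

lemma tendsto_of_forall_integral_tendsto_of_denseRange [CompactSpace X] {κ : Type*}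
    {Ψ : κ → C(X, I)} (hΨ : DenseRange Ψ)
    (h : ∀ i, Tendsto (fun k => ∫ x, (Ψ i x : ℝ) ∂(u k : Measure X)) L
      (𝓝 (∫ x, (Ψ i x : ℝ) ∂(μ : Measure X)))) : Tendsto u L (𝓝 μ) := by
  have equicontinuous : Equicontinuous fun (k : ι) (g : C(X, I)) =>
      ∫ x, (g x : ℝ) ∂(u k : Measure X) :=
    (LipschitzWith.uniformEquicontinuous _ 1 fun k =>
      lipschitzWith_integral_coe_unitInterval (u k : Measure X)).equicontinuous
  have continuous_limit := (lipschitzWith_integral_coe_unitInterval (μ : Measure X)).continuous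
  refine tendsto_of_forall_integral_coe_unitInterval_tendsto fun g => ?_
  exact hΨ.induction_on g (equicontinuous.isClosed_setOfPred_tendsto continuous_limit) h

lemma isOpen_setOf_measure_pos [HasOuterApproxClosed X] {U : Set X} (hU : IsOpen U) :
    IsOpen {ν : ProbabilityMeasure X | 0 < (ν : Measure X) U} :=
  isOpen_iff_mem_nhds.2 fun _ hν => eventually_lt_of_lt_liminf <| hν.trans_le <|
    ProbabilityMeasure.le_liminf_measure_open_of_tendsto tendsto_id hU

end WeakConvergence

section MeasureDist

variable (Ψ : ℕ → C(I, I)) (μ ν ρ : ProbabilityMeasure I)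

lemma summable_one_div_two_pow_succ : Summable fun i : ℕ => (1 / 2 ^ (i + 1) : ℝ) := by
  simpa only [one_div_pow] using (summable_nat_add_iff 1).2 summable_geometric_two

lemma measureDist_term_le (i : ℕ) :
    (1 / 2 ^ (i + 1)) *
      |(∫ x, (Ψ i x : ℝ) ∂(μ : Measure I)) - ∫ x, (Ψ i x : ℝ) ∂(ν : Measure I)|
      ≤ (1 / 2 ^ (i + 1) : ℝ) :=
  mul_le_of_le_one_right (by positivity) <| Real.dist_le_of_mem_Icc_01
    (integral_coe_unitInterval_mem_Icc (Ψ i).continuous.aemeasurable)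
    (integral_coe_unitInterval_mem_Icc (Ψ i).continuous.aemeasurable)

lemma summable_measureDist :
    Summable fun i : ℕ => (1 / 2 ^ (i + 1) : ℝ) *
      |(∫ x, (Ψ i x : ℝ) ∂(μ : Measure I)) - ∫ x, (Ψ i x : ℝ) ∂(ν : Measure I)| :=
  summable_one_div_two_pow_succ.of_nonneg_of_le (fun _ => by positivity)
    (measureDist_term_le Ψ μ ν)

lemma measureDist_nonneg : 0 ≤ measureDist Ψ μ ν :=
  tsum_nonneg fun _ => by positivity

lemma measureDist_self : measureDist Ψ μ μ = 0 := by
  simp [measureDist]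

lemma measureDist_triangle : measureDist Ψ μ ρ ≤ measureDist Ψ μ ν + measureDist Ψ ν ρ := by
  have summable_add := (summable_measureDist Ψ μ ν).add (summable_measureDist Ψ ν ρ)
  rw [measureDist, measureDist, measureDist,
    ← (summable_measureDist Ψ μ ν).tsum_add (summable_measureDist Ψ ν ρ)]
  refine (summable_measureDist Ψ μ ρ).tsum_le_tsum (fun i => ?_) summable_add
  rw [← mul_add]
  gcongr
  exact abs_sub_le _ _ _

lemma abs_integral_sub_integral_le_measureDist (i : ℕ) :
    |(∫ x, (Ψ i x : ℝ) ∂(μ : Measure I)) - ∫ x, (Ψ i x : ℝ) ∂(ν : Measure I)|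
      ≤ 2 ^ (i + 1) * measureDist Ψ μ ν := by
  rw [← div_le_iff₀' (by positivity), div_eq_mul_one_div, mul_comm]
  exact (summable_measureDist Ψ μ ν).le_tsum i fun _ _ => by positivity

lemma continuous_measureDist_left : Continuous fun ν => measureDist Ψ ν μ := by
  refine continuous_tsum (fun i => ?_) summable_one_div_two_pow_succ fun i ν => ?_
  · exact ((continuous_integral_coe_unitInterval (Ψ i)).sub continuous_const).abs.const_mul _
  · rw [Real.norm_of_nonneg (by positivity)]
    exact measureDist_term_le Ψ ν μ i

variable {Ψ}

lemma nhds_eq_comap_measureDist (hΨ : DenseRange Ψ) :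
    𝓝 μ = comap (fun ν => measureDist Ψ ν μ) (𝓝 0) := by
  refine le_antisymm ?_ ?_
  · rw [← measureDist_self Ψ μ]
    exact (continuous_measureDist_left Ψ μ).continuousAt.le_comap
  · refine tendsto_id'.1 (tendsto_of_forall_integral_tendsto_of_denseRange hΨ fun i => ?_)
    have bound_tendsto := (tendsto_comap (f := fun ν => measureDist Ψ ν μ) (x := 𝓝 0)).const_mul
      ((2 : ℝ) ^ (i + 1))
    rw [mul_zero] at bound_tendsto
    exact tendsto_iff_dist_tendsto_zero.2 <| squeeze_zero (fun _ => dist_nonneg)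
      (fun ν => abs_integral_sub_integral_le_measureDist Ψ ν μ i) bound_tendsto

lemma nhds_basis_measureDist (hΨ : DenseRange Ψ) :
    (𝓝 μ).HasBasis (fun ε : ℝ => 0 < ε) fun ε => {ν | measureDist Ψ ν μ < ε} := by
  rw [nhds_eq_comap_measureDist μ hΨ]
  simpa only [Set.preimage_ofPred_eq, abs_of_nonneg (measureDist_nonneg Ψ _ μ)]
    using (nhds_basis_zero_abs_lt ℝ).comap fun ν => measureDist Ψ ν μ

lemma measureInfDist_lt_ofReal_iff {S : Set (ProbabilityMeasure I)} {ε : ℝ} (hε : 0 < ε) :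
    measureInfDist Ψ S μ < ENNReal.ofReal ε ↔ ∃ ν ∈ S, measureDist Ψ ν μ < ε := by
  simp only [measureInfDist, iInf_lt_iff, ENNReal.ofReal_lt_ofReal_iff hε, exists_prop]

end MeasureDist

section InvariantMeasures

variable {f : C(I, I)}

lemma isClosed_invariantMeasures : IsClosed (invariantMeasures f) := by
  have invariant_iff (μ : ProbabilityMeasure I) :
      μ ∈ invariantMeasures f ↔ μ.map f.continuous.aemeasurable = μ :=
    ⟨fun h => Subtype.ext (MeasurePreserving.map_eq h),
      fun h => ⟨f.continuous.measurable, congrArg Subtype.val h⟩⟩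
  rw [Set.ext invariant_iff]
  exact isClosed_eq (ProbabilityMeasure.continuous_map f.continuous) continuous_id

lemma diracProba_mem_invariantMeasures {p : I} (hp : Function.IsFixedPt f p) :
    diracProba p ∈ invariantMeasures f :=
  ⟨f.continuous.measurable, (Measure.map_dirac' f.continuous.measurable p).trans
    (congrArg Measure.dirac hp)⟩

lemma coe_empiricalMeasure (f : C(I, I)) (x : I) (n : ℕ) : (empiricalMeasure f x n : Measure I) =
    ((n + 1 : ℕ) : ℝ≥0∞)⁻¹ • ∑ j ∈ Finset.range (n + 1), Measure.dirac (f^[j] x) := rfl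

lemma integral_empiricalMeasure {E : Type*} [NormedAddCommGroup E] [NormedSpace ℝ E]
    [CompleteSpace E] (φ : I → E) (x : I) (n : ℕ) :
    ∫ y, φ y ∂(empiricalMeasure f x n : Measure I) = birkhoffAverage ℝ f φ (n + 1) x := by
  rw [coe_empiricalMeasure, integral_smul_measure,
    integral_finsetSum_measure fun j _ => integrable_dirac enorm_lt_top, ENNReal.toReal_inv,
    ENNReal.toReal_natCast]
  simp [birkhoffAverage, birkhoffSum]

lemma birkhoffAverage_comp_self (R : Type*) {α M : Type*} [DivisionSemiring R] [AddCommMonoid M]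
    [Module R M] (f : α → α) (g : α → M) (n : ℕ) (x : α) :
    birkhoffAverage R f (g ∘ f) n x = birkhoffAverage R f g n (f x) := by
  simp only [birkhoffAverage, birkhoffSum, Function.comp_apply, ← Function.iterate_succ_apply' f,
    Function.iterate_succ_apply]

lemma pOmega_subset_invariantMeasures (x : I) : pOmega f x ⊆ invariantMeasures f := by
  rintro μ ⟨θ, hθ, hlim⟩
  have := Measure.isProbabilityMeasure_map (μ := (μ : Measure I)) f.continuous.aemeasurable
  refine ⟨f.continuous.measurable, ext_of_forall_integral_eq_of_IsFiniteMeasure fun φ => ?_⟩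
  rw [integral_map f.continuous.aemeasurable φ.continuous.aestronglyMeasurable, ← sub_eq_zero]
  rw [ProbabilityMeasure.tendsto_iff_forall_integral_tendsto] at hlim
  have averages_tendsto_sub := (hlim (φ.compContinuous f)).sub (hlim φ)
  have averages_tendsto_zero := (tendsto_birkhoffAverage_apply_sub_birkhoffAverage' ℝ
    φ.isBounded_range f x).comp ((tendsto_add_atTop_nat 1).comp hθ.tendsto_atTop)
  refine tendsto_nhds_unique averages_tendsto_sub (averages_tendsto_zero.congr fun k => ?_)
  simp only [integral_empiricalMeasure, Function.comp_apply, ← birkhoffAverage_comp_self]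
  rfl

end InvariantMeasures

section PseudoPhysical

variable {Ψ : ℕ → C(I, I)} {f : C(I, I)}

lemma pseudoPhysicalMeasures_subset_closure (hΨ : DenseRange Ψ) :
    pseudoPhysicalMeasures Ψ f ⊆ closure (⋃ x, pOmega f x) := by
  intro μ hμ
  refine (mem_closure_iff_nhds_basis (nhds_basis_measureDist μ hΨ)).2 fun ε hε => ?_
  obtain ⟨x, hx⟩ := nonempty_of_measure_ne_zero (hμ ε hε).ne'
  obtain ⟨ν, hν, hlt⟩ := (measureInfDist_lt_ofReal_iff μ hε).1 hx
  exact ⟨ν, Set.mem_iUnion.2 ⟨x, hν⟩, hlt⟩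

lemma pseudoPhysicalMeasures_subset_invariantMeasures (hΨ : DenseRange Ψ) :
    pseudoPhysicalMeasures Ψ f ⊆ invariantMeasures f :=
  (pseudoPhysicalMeasures_subset_closure hΨ).trans <| closure_minimal
    (Set.iUnion_subset pOmega_subset_invariantMeasures) isClosed_invariantMeasures

lemma isClosed_pseudoPhysicalMeasures : IsClosed (pseudoPhysicalMeasures Ψ f) := by
  refine isClosed_of_closure_subset fun μ hμ ε hε => ?_
  have near_μ : {ν | measureDist Ψ ν μ < ε / 2} ∈ 𝓝 μ :=
    (continuous_measureDist_left Ψ μ).continuousAt.eventually_lt_const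
      (by simpa [measureDist_self] using hε)
  obtain ⟨ν, hνμ, hν⟩ := mem_closure_iff_nhds.1 hμ _ near_μ
  refine (hν (ε / 2) (half_pos hε)).trans_le (measure_mono fun x hx => ?_)
  obtain ⟨ρ, hρ, hρν⟩ := (measureInfDist_lt_ofReal_iff ν (half_pos hε)).1 hx
  refine (measureInfDist_lt_ofReal_iff μ hε).2 ⟨ρ, hρ, ?_⟩
  calc measureDist Ψ ρ μ ≤ measureDist Ψ ρ ν + measureDist Ψ ν μ := measureDist_triangle Ψ ρ ν μ
    _ < ε / 2 + ε / 2 := add_lt_add hρν hνμ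
    _ = ε := add_halves ε

lemma isClosed_pseudoPhysicalInInvariant : IsClosed (pseudoPhysicalInInvariant Ψ f) :=
  isClosed_pseudoPhysicalMeasures.preimage continuous_subtype_val

end PseudoPhysical

section ForwardInvariantSets

variable {Ψ : ℕ → C(I, I)} {f : C(I, I)} {U V : Set I}

lemma exists_iterate_mem_of_empiricalMeasure_pos {x : I} {n : ℕ}
    (h : 0 < (empiricalMeasure f x n : Measure I) U) : ∃ j, f^[j] x ∈ U := by
  contrapose! h
  simp [coe_empiricalMeasure, Measure.finsetSum_apply, h]

lemma exists_iterate_mem_of_mem_pOmega {x : I} {ν : ProbabilityMeasure I} (hν : ν ∈ pOmega f x)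
    (hU : IsOpen U) (hνU : 0 < (ν : Measure I) U) : ∃ j, f^[j] x ∈ U := by
  obtain ⟨θ, -, hlim⟩ := hν
  obtain ⟨k, hk⟩ := (hlim.eventually ((isOpen_setOf_measure_pos hU).mem_nhds hνU)).exists
  exact exists_iterate_mem_of_empiricalMeasure_pos hk

lemma not_disjoint_of_iterate_mem {α : Type*} {f : α → α} {U V : Set α} (hfU : Set.MapsTo f U U)
    (hfV : Set.MapsTo f V V) {x : α} {i j : ℕ} (hi : f^[i] x ∈ U) (hj : f^[j] x ∈ V) :
    ¬Disjoint U V := by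
  refine Set.not_disjoint_iff.2 ⟨f^[i + j] x, ?_, ?_⟩
  · rw [add_comm, Function.iterate_add_apply]
    exact hfU.iterate j hi
  · rw [Function.iterate_add_apply]
    exact hfV.iterate i hj

lemma notMem_pseudoPhysicalMeasures (hΨ : DenseRange Ψ) (hU : IsOpen U) (hV : IsOpen V)
    (hUV : Disjoint U V) (hfU : Set.MapsTo f U U) (hfV : Set.MapsTo f V V)
    {μ : ProbabilityMeasure I} (hμU : 0 < (μ : Measure I) U) (hμV : 0 < (μ : Measure I) V) :
    μ ∉ pseudoPhysicalMeasures Ψ f := by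
  intro hμ
  obtain ⟨ν, ⟨hνU, hνV⟩, hν⟩ := mem_closure_iff.1 (pseudoPhysicalMeasures_subset_closure hΨ hμ) _
    ((isOpen_setOf_measure_pos hU).inter (isOpen_setOf_measure_pos hV)) ⟨hμU, hμV⟩
  obtain ⟨x, hx⟩ := Set.mem_iUnion.1 hν
  obtain ⟨i, hi⟩ := exists_iterate_mem_of_mem_pOmega hx hU hνU
  obtain ⟨j, hj⟩ := exists_iterate_mem_of_mem_pOmega hx hV hνV
  exact not_disjoint_of_iterate_mem hfU hfV hi hj hUV

end ForwardInvariantSets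

section Mixture

open unitInterval

variable {X : Type*} [MeasurableSpace X]

/-- The convex combination `(1 - t) μ + t ν` of two probability measures. -/
noncomputable def mixture (t : I) (μ ν : ProbabilityMeasure X) : ProbabilityMeasure X :=
  ⟨toNNReal (σ t) • (μ : Measure X) + toNNReal t • (ν : Measure X),
    ⟨by simp [← ENNReal.coe_add]⟩⟩

variable {μ ν : ProbabilityMeasure X} {t : I}

lemma coe_mixture (t : I) (μ ν : ProbabilityMeasure X) : (mixture t μ ν : Measure X) =
    toNNReal (σ t) • (μ : Measure X) + toNNReal t • (ν : Measure X) := rfl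

lemma mixture_zero (μ ν : ProbabilityMeasure X) : mixture 0 μ ν = μ :=
  Subtype.ext <| (coe_mixture 0 μ ν).trans <| by simp

lemma measurePreserving_mixture {Y : Type*} [MeasurableSpace Y] {f : X → Y}
    {μ' ν' : ProbabilityMeasure Y} (t : I) (hμ : MeasurePreserving f (μ : Measure X) μ')
    (hν : MeasurePreserving f (ν : Measure X) ν') :
    MeasurePreserving f (mixture t μ ν : Measure X) (mixture t μ' ν') := by
  refine ⟨hμ.measurable, ?_⟩
  rw [coe_mixture, coe_mixture, Measure.map_add _ _ hμ.measurable, Measure.map_smul,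
    Measure.map_smul, hμ.map_eq, hν.map_eq]

lemma toNNReal_ne_zero_of_pos (ht : 0 < t) : toNNReal t ≠ 0 :=
  fun h => ht.ne' <| Subtype.ext <| congrArg NNReal.toReal h

lemma absolutelyContinuous_mixture_left (ht : t < 1) (μ ν : ProbabilityMeasure X) :
    (μ : Measure X) ≪ mixture t μ ν :=
  (Measure.absolutelyContinuous_smul <| ENNReal.coe_ne_zero.2 <| toNNReal_ne_zero_of_pos <|
    lt_symm_comm.2 <| by rwa [symm_zero]).add_right _

lemma absolutelyContinuous_mixture_right (ht : 0 < t) (μ ν : ProbabilityMeasure X) :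
    (ν : Measure X) ≪ mixture t μ ν :=
  (Measure.absolutelyContinuous_smul <| ENNReal.coe_ne_zero.2 <|
    toNNReal_ne_zero_of_pos ht).add_right' _

lemma continuous_mixture [TopologicalSpace X] [OpensMeasurableSpace X]
    (μ ν : ProbabilityMeasure X) : Continuous fun t => mixture t μ ν := by
  refine ProbabilityMeasure.continuous_iff_forall_continuous_integral.2 fun φ => ?_
  have integral_mixture (t : I) : ∫ x, φ x ∂(mixture t μ ν : Measure X) =
      toNNReal (σ t) • ∫ x, φ x ∂(μ : Measure X) + toNNReal t • ∫ x, φ x ∂(ν : Measure X) := by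
    rw [coe_mixture, integral_add_measure ((φ.integrable _).smul_measure_nnreal)
      ((φ.integrable _).smul_measure_nnreal), integral_smul_nnreal_measure,
      integral_smul_nnreal_measure]
  simp only [integral_mixture]
  fun_prop

end Mixture

section FixedPoints

lemma exists_isFixedPt_mem_Ioo {α : Type*} [ConditionallyCompleteLinearOrder α]
    [TopologicalSpace α] [OrderTopology α] [DenselyOrdered α] {f : α → α} {a b : α}
    (hf : ContinuousOn f (Set.Icc a b)) (hab : a ≤ b)
    (h : Set.MapsTo f (Set.Icc a b) (Set.Ioo a b)) : ∃ p ∈ Set.Ioo a b, Function.IsFixedPt f p := by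
  obtain ⟨p, hp, hfix⟩ := exists_mem_Icc_isFixedPt_of_mapsTo hf hab
    (h.mono_right Set.Ioo_subset_Icc_self)
  exact ⟨p, hfix.eq ▸ h hp, hfix⟩

variable {Ψ : ℕ → C(I, I)} {f : C(I, I)} {U V : Set I}

lemma exists_mem_invariantMeasures_pos {p q : I} (hp : Function.IsFixedPt f p)
    (hq : Function.IsFixedPt f q) (hpU : p ∈ U) (hqV : q ∈ V) :
    ∃ η ∈ invariantMeasures f, 0 < (η : Measure I) U ∧ 0 < (η : Measure I) V := by
  obtain ⟨t, ht₀, ht₁⟩ := exists_between (zero_lt_one (α := I))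
  refine ⟨mixture t (diracProba p) (diracProba q), measurePreserving_mixture t
    (diracProba_mem_invariantMeasures hp) (diracProba_mem_invariantMeasures hq), ?_, ?_⟩
  · exact (absolutelyContinuous_mixture_left ht₁ _ _).pos_mono (by simp [hpU])
  · exact (absolutelyContinuous_mixture_right ht₀ _ _).pos_mono (by simp [hqV])

lemma dense_compl_pseudoPhysicalInInvariant (hΨ : DenseRange Ψ) (hU : IsOpen U) (hV : IsOpen V)
    (hUV : Disjoint U V) (hfU : Set.MapsTo f U U) (hfV : Set.MapsTo f V V)
    {η : ProbabilityMeasure I} (hη : η ∈ invariantMeasures f) (hηU : 0 < (η : Measure I) U)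
    (hηV : 0 < (η : Measure I) V) : Dense (pseudoPhysicalInInvariant Ψ f)ᶜ := by
  rintro ⟨μ, hμ⟩
  let γ (t : I) : invariantMeasures f := ⟨mixture t μ η, measurePreserving_mixture t hμ hη⟩
  have hγ : Continuous γ := (continuous_mixture μ η).subtype_mk _
  have hγ_zero : γ 0 = ⟨μ, hμ⟩ := Subtype.ext (mixture_zero μ η)
  have zero_mem : (0 : I) ∈ closure (Set.Ioi 0) := by
    rw [closure_Ioi' ⟨1, zero_lt_one⟩]
    exact Set.self_mem_Ici
  rw [← hγ_zero]
  refine map_mem_closure hγ zero_mem fun t ht => ?_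
  have η_ac := absolutelyContinuous_mixture_right ht μ η
  exact notMem_pseudoPhysicalMeasures hΨ hU hV hUV hfU hfV (η_ac.pos_mono hηU) (η_ac.pos_mono hηV)

end FixedPoints

section TwoTraps

/-- The maps that send each of two disjoint closed intervals into its own interior; they form the
open dense set that witnesses typicality. -/
def twoTrapMaps : Set C(I, I) :=
  {f | ∃ a b c d : I, a < b ∧ b < c ∧ c < d ∧
    Set.MapsTo f (Set.Icc a b) (Set.Ioo a b) ∧ Set.MapsTo f (Set.Icc c d) (Set.Ioo c d)}

lemma dense_compl_of_mem_twoTrapMaps {Ψ : ℕ → C(I, I)} (hΨ : DenseRange Ψ) {f : C(I, I)}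
    (hf : f ∈ twoTrapMaps) : Dense (pseudoPhysicalInInvariant Ψ f)ᶜ := by
  obtain ⟨a, b, c, d, hab, hbc, hcd, h₁, h₂⟩ := hf
  obtain ⟨p, hp, hfp⟩ := exists_isFixedPt_mem_Ioo f.continuous.continuousOn hab.le h₁
  obtain ⟨q, hq, hfq⟩ := exists_isFixedPt_mem_Ioo f.continuous.continuousOn hcd.le h₂
  obtain ⟨η, hη, hη₁, hη₂⟩ := exists_mem_invariantMeasures_pos hfp hfq hp hq
  have disjoint_traps : Disjoint (Set.Ioo a b) (Set.Ioo c d) :=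
    Set.disjoint_left.2 fun x hx hx' => lt_asymm (hx.2.trans hbc) hx'.1
  exact dense_compl_pseudoPhysicalInInvariant hΨ isOpen_Ioo isOpen_Ioo disjoint_traps
    (h₁.mono_left Set.Ioo_subset_Icc_self) (h₂.mono_left Set.Ioo_subset_Icc_self) hη hη₁ hη₂

lemma isOpen_twoTrapMaps : IsOpen twoTrapMaps := by
  rw [isOpen_iff_mem_nhds]
  rintro f ⟨a, b, c, d, hab, hbc, hcd, h₁, h₂⟩
  filter_upwards [ContinuousMap.eventually_mapsTo isCompact_Icc isOpen_Ioo h₁,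
    ContinuousMap.eventually_mapsTo isCompact_Icc isOpen_Ioo h₂] with g hg₁ hg₂
  exact ⟨a, b, c, d, hab, hbc, hcd, hg₁, hg₂⟩

lemma exists_dist_le_eqOn_of_isClosed {X : Type*} [TopologicalSpace X] [CompactSpace X]
    [NormalSpace X] (f : C(X, I)) {K : Set X} (hK : IsClosed K) {h : X → I}
    (hh : ContinuousOn h K) {ε : ℝ} (hε : 0 ≤ ε) (hhf : ∀ x ∈ K, dist (h x) (f x) ≤ ε) :
    ∃ g : C(X, I), dist g f ≤ ε ∧ Set.EqOn g h K := by
  -- Tietze applies to the error `h - f`, not to `h`; projecting `f + Δ` onto `[0, 1]` keeps both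
  -- properties because `f` and `h` take values there.
  let δ : C(K, ℝ) := ⟨fun x => (h x : ℝ) - f x,
    (continuous_subtype_val.comp hh.domRestrict).sub (by fun_prop)⟩
  obtain ⟨Δ, hΔε, hΔ⟩ := δ.exists_restrict_eq_forall_mem_of_closed (t := Set.Icc (-ε) ε)
    (fun x => abs_le.1 (hhf x x.2)) ⟨0, by simpa using hε⟩ hK
  let g : C(X, I) := ⟨fun x => Set.projIcc 0 1 zero_le_one (f x + Δ x), by fun_prop⟩
  refine ⟨g, (ContinuousMap.dist_le hε).2 fun x => ?_, fun x hx => ?_⟩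
  · calc dist (g x) (f x) = dist (g x) (Set.projIcc 0 1 zero_le_one (f x : ℝ)) := by
          rw [Set.projIcc_val]
      _ ≤ |f x + Δ x - f x| := Set.abs_projIcc_sub_projIcc zero_le_one
      _ = |Δ x| := by rw [add_sub_cancel_left]
      _ ≤ ε := abs_le.2 (hΔε x)
  · have hΔx : Δ x = h x - f x := DFunLike.congr_fun hΔ ⟨x, hx⟩
    rw [ContinuousMap.coe_mk, hΔx, add_sub_cancel, Set.projIcc_val]

lemma exists_lt_Icc_subset_of_mem_nhds {α : Type*} [LinearOrder α] [TopologicalSpace α]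
    [OrderTopology α] {p : α} [NeBot (𝓝[≠] p)] {W : Set α} (hW : W ∈ 𝓝 p) :
    ∃ a b : α, a < b ∧ Set.Icc a b ⊆ W := by
  obtain ⟨a, b, -, hab, hsub⟩ := exists_Icc_mem_subset_of_mem_nhds hW
  obtain ⟨x, hx, y, hy, hxy⟩ := (infinite_of_mem_nhds p hab).nontrivial.exists_lt
  exact ⟨x, y, hxy, (Set.Icc_subset_Icc hx.1 hy.2).trans hsub⟩

lemma exists_Icc_forall_dist_le (f : C(I, I)) {ε : ℝ} (hε : 0 < ε) :
    ∃ a b : I, a < b ∧ ∀ x ∈ Set.Icc a b, ∀ y ∈ Set.Icc a b, dist y (f x) ≤ ε := by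
  obtain ⟨p, -, hp⟩ := exists_mem_Icc_isFixedPt_of_mapsTo (a := (0 : I)) (b := 1)
    f.continuous.continuousOn zero_le_one fun x _ => ⟨unitInterval.nonneg', unitInterval.le_one'⟩
  have near_p : ∀ᶠ x in 𝓝 p, dist x p < ε / 2 ∧ dist (f x) p < ε / 2 :=
    (Metric.tendsto_nhds.1 tendsto_id _ (half_pos hε)).and
      (Metric.tendsto_nhds.1 (f.continuous.tendsto' p p hp) _ (half_pos hε))
  obtain ⟨a, b, hab, hsub⟩ := exists_lt_Icc_subset_of_mem_nhds near_p
  refine ⟨a, b, hab, fun x hx y hy => ?_⟩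
  linarith [dist_triangle_right y (f x) p, (hsub hx).2, (hsub hy).1]

lemma continuousOn_ite_lt_const {α β : Type*} [LinearOrder α] [TopologicalSpace α]
    [OrderTopology α] [TopologicalSpace β] (a b c d : α) (hbc : b < c) (q r : β) :
    ContinuousOn (fun x => if x < c then q else r) (Set.Icc a b ∪ Set.Icc c d) := by
  refine ContinuousOn.union_of_isClosed ?_ ?_ isClosed_Icc isClosed_Icc
  · exact continuousOn_const.congr fun x hx => if_pos (hx.2.trans_lt hbc)
  · exact continuousOn_const.congr fun x hx => if_neg hx.1.not_gt

lemma dense_twoTrapMaps : Dense twoTrapMaps := by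
  refine Metric.dense_iff.2 fun f ε hε => ?_
  obtain ⟨a, d, had, hclose⟩ := exists_Icc_forall_dist_le f (half_pos hε)
  obtain ⟨b, hab, hbd⟩ := exists_between had
  obtain ⟨c, hbc, hcd⟩ := exists_between hbd
  obtain ⟨q, hq⟩ := exists_between hab
  obtain ⟨r, hr⟩ := exists_between hcd
  let h (x : I) : I := if x < c then q else r
  have h_mem (x : I) : h x ∈ Set.Icc a d := by
    dsimp only [h]
    split_ifs
    exacts [⟨hq.1.le, (hq.2.trans hbd).le⟩, ⟨((hab.trans hbc).trans hr.1).le, hr.2.le⟩]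
  have traps_subset : Set.Icc a b ∪ Set.Icc c d ⊆ Set.Icc a d := Set.union_subset
    (Set.Icc_subset_Icc_right hbd.le) (Set.Icc_subset_Icc_left (hab.trans hbc).le)
  obtain ⟨g, hgf, hg⟩ := exists_dist_le_eqOn_of_isClosed f (isClosed_Icc.union isClosed_Icc)
    (h := h) (continuousOn_ite_lt_const a b c d hbc q r) (half_pos hε).le
    fun x hx => hclose x (traps_subset hx) (h x) (h_mem x)
  refine ⟨g, hgf.trans_lt (half_lt_self hε), a, b, c, d, hab, hbc, hcd, fun x hx => ?_,
    fun x hx => ?_⟩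
  · rwa [hg (.inl hx), show h x = q from if_pos (hx.2.trans_lt hbc)]
  · rwa [hg (.inr hx), show h x = r from if_neg hx.1.not_gt]

end TwoTraps

end IntervalDynamics

theorem mainTheorem2 (Ψ : ℕ → C(unitInterval, unitInterval)) (hΨ : DenseRange Ψ) :
    IntervalDynamics.IsTypical fun f =>
      IntervalDynamics.pseudoPhysicalMeasures Ψ f ⊆ IntervalDynamics.invariantMeasures f ∧
      IsClosed (IntervalDynamics.pseudoPhysicalInInvariant Ψ f) ∧
      interior (IntervalDynamics.pseudoPhysicalInInvariant Ψ f) = ∅ ∧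
      IsMeagre (IntervalDynamics.pseudoPhysicalInInvariant Ψ f) ∧
      Dense (IntervalDynamics.pseudoPhysicalInInvariant Ψ f)ᶜ := by
  refine ⟨IntervalDynamics.twoTrapMaps, IntervalDynamics.isOpen_twoTrapMaps.isGδ,
    IntervalDynamics.dense_twoTrapMaps, fun f hf => ?_⟩
  have hclosed := IntervalDynamics.isClosed_pseudoPhysicalInInvariant (Ψ := Ψ) (f := f)
  have hdense := IntervalDynamics.dense_compl_of_mem_twoTrapMaps hΨ hf
  have hinterior := interior_eq_empty_iff_dense_compl.2 hdense
  exact ⟨IntervalDynamics.pseudoPhysicalMeasures_subset_invariantMeasures hΨ, hclosed, hinterior,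
    (hclosed.isNowhereDense_iff.2 hinterior).isMeagre, hdense⟩
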